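/- For $d>0$ and $n\ge 1$ let $\mathbf A=\mathbf A(n,p)$ be the random $n\times n$ matrix over $\mathbb F_2$ whose entries are independently equal to $1$ with probability $p=\min\{d/n,1\}$ and equal to $0$ otherwise. Given $\mathbf A$, let $\mathbf x=(\mathbf x_1,\ldots,\mathbf x_n)$ be a uniformly random element of $\ker\mathbf A=\{x\in\mathbb F_2^n:\mathbf Ax=0\}$. For every integer $\ell\ge 1$ there exists $\gamma>0$ such that for all $d>0$ and all $\sigma\in\mathbb F_2^\ell$, $$\lim_{n\to\infty}\mathbb E\left[n^{\gamma}\left|\mathbb P\left[\mathbf x_1=\sigma_1,\ldots,\mathbf x_\ell=\sigma_\ell\mid\mathbf A\right]-\prod_{i=1}^{\ell}\mathbb P\left[\mathbf x_i=\sigma_i\mid\mathbf A\right]\right|\right]=0,$$ where the limit is over $n\ge\ell$. -/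

import Mathlib

open Filter Topology

noncomputable section

namespace SparseParity

/-- The entry probability `p = (d / n) ∧ 1`. -/
def entryProb (d : ℝ) (n : ℕ) : ℝ := min (d / n) 1

/-- The probability that the random `n × n` matrix over `𝔽₂`, whose entries are independently
equal to `1` with probability `p = (d / n) ∧ 1` and to `0` otherwise, takes the value `A`. -/
def matrixProb (d : ℝ) (n : ℕ) (A : Matrix (Fin n) (Fin n) (ZMod 2)) : ℝ :=
  ∏ i, ∏ j, if A i j = 1 then entryProb d n else 1 - entryProb d n

/-- The expectation of `F 𝐀` over the random matrix `𝐀`. -/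
def expect (d : ℝ) (n : ℕ) (F : Matrix (Fin n) (Fin n) (ZMod 2) → ℝ) : ℝ :=
  ∑ A, matrixProb d n A * F A

/-- The probability that a uniformly random element `x` of `ker A` satisfies `P`. -/
def kerProb {n : ℕ} (A : Matrix (Fin n) (Fin n) (ZMod 2)) (P : (Fin n → ZMod 2) → Prop) : ℝ :=
  (Nat.card {x : LinearMap.ker A.mulVecLin // P x} : ℝ) / Nat.card (LinearMap.ker A.mulVecLin)

/-- For a uniformly random `x ∈ ker A`, the absolute difference between the probability that the
first `ℓ` coordinates of `x` are `σ` and the product of the corresponding marginals. -/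
def gap {n ℓ : ℕ} (h : ℓ ≤ n) (σ : Fin ℓ → ZMod 2) (A : Matrix (Fin n) (Fin n) (ZMod 2)) : ℝ :=
  |kerProb A (fun x => ∀ i : Fin ℓ, x (Fin.castLE h i) = σ i)
    - ∏ i : Fin ℓ, kerProb A (fun x => x (Fin.castLE h i) = σ i)|

end SparseParity

end

/-! A uniform kernel vector fails to have independent first `ℓ` coordinates only if some coordinate
that is free in the kernel becomes frozen once the earlier ones are set to zero; the gap is at most
the number of such coordinates (`gap_le_sum`). Adding a random row intersects the solution set with
a random hyperplane. On functions of sets this is an averaging operator `T = rowOp`, and the kernel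
is distributed according to `T ^ n`. Pinning a random coordinate is an operator `P = pinOp` of the
same kind, and all these operators are commuting sup-norm contractions. With probability bounded
below a row is zero (operator `1`) or a uniformly random unit vector (operator `P`). The number of
such rows fluctuates on the scale `√n`, so one more is barely noticed: `T ^ n * (T - 1)` and `T ^ n
* (T - P)` have norm `O(n ^ (-1/2))` (`norm_pow_mul_sub_le`). Hence so has `T ^ n * (1 - P)`.
Applied to the fraction of free coordinates, this bounds the probability that pinning random
coordinates freezes another (`sum_becomesFrozen`); exchangeability of the columns carries the bound
over to the first `ℓ` coordinates. -/

namespace SparseParity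

/-! ### Powers of a convex combination of commuting contractions. -/

section NormedRing

/-- Cauchy–Schwarz against the binomial variance `n q (1 - q)`. -/
theorem sum_binomial_abs_deviation_le (n : ℕ) {q : ℝ} (hq0 : 0 ≤ q) (hq1 : q ≤ 1) :
    ∑ k ∈ Finset.range (n + 1), (n.choose k * q ^ k * (1 - q) ^ (n - k)) * |n * q - k|
      ≤ √(n * q) := by
  have hb : ∀ k, 0 ≤ (n.choose k : ℝ) * q ^ k * (1 - q) ^ (n - k) := fun k => by
    have : 0 ≤ 1 - q := by linarith
    positivity
  have hvar : ∑ k ∈ Finset.range (n + 1),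
      (n.choose k * q ^ k * (1 - q) ^ (n - k)) * (n * q - k) ^ 2 = n * q * (1 - q) := by
    have := congrArg (Polynomial.eval q) (bernsteinPolynomial.variance ℝ n)
    simp only [Polynomial.eval_finsetSum, bernsteinPolynomial, Polynomial.eval_mul,
      Polynomial.eval_pow, Polynomial.eval_sub, Polynomial.eval_one, Polynomial.eval_X,
      Polynomial.eval_natCast, nsmul_eq_mul] at this
    rw [← this]
    exact Finset.sum_congr rfl fun k _ => by ring
  have hsum : ∑ k ∈ Finset.range (n + 1), ((n.choose k : ℝ) * q ^ k * (1 - q) ^ (n - k)) = 1 := by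
    have := add_pow q (1 - q) n
    rw [add_sub_cancel, one_pow] at this
    exact (Finset.sum_congr rfl fun k _ => by ring).trans this.symm
  apply Real.le_sqrt_of_sq_le
  have hcs := Finset.sum_mul_sq_le_sq_mul_sq (Finset.range (n + 1))
    (fun k => √((n.choose k : ℝ) * q ^ k * (1 - q) ^ (n - k)))
    (fun k => √((n.choose k : ℝ) * q ^ k * (1 - q) ^ (n - k)) * |n * q - k|)
  simp only [mul_pow, Real.sq_sqrt (hb _), sq_abs, ← mul_assoc, Real.mul_self_sqrt (hb _)] at hcs
  rw [hvar, hsum, one_mul] at hcs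
  refine hcs.trans ?_
  have : 0 ≤ (n : ℝ) * q := by positivity
  nlinarith

variable {𝔸 : Type*} [NormedRing 𝔸]

/-- Expanding binomially, multiplication by `(n + 1) q` turns the product into a sum of `a ^ k * b ^
(n + 1 - k)` with binomial coefficients weighted by `(n + 1) q - k`. Its norm is at most the mean
absolute deviation of a binomial variable. -/
theorem norm_pow_mul_sub_le [NormedAlgebra ℝ 𝔸] {q : ℝ} (hq : 0 < q) (hq1 : q ≤ 1) {a b : 𝔸} (hab : Commute a b)
    (h1 : ‖(1 : 𝔸)‖ ≤ 1) (ha : ‖a‖ ≤ 1) (hb : ‖b‖ ≤ 1 - q) (n : ℕ) :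
    ‖(q • a + b) ^ n * (q • a + b - a)‖ ≤ 1 / √((n + 1) * q) := by
  set r := q • a + b with hr
  have hpow : ∀ (x : 𝔸) {c : ℝ}, ‖x‖ ≤ c → ∀ m : ℕ, ‖x ^ m‖ ≤ c ^ m := by
    intro x c hx m
    induction m with
    | zero => simpa using h1
    | succ m ih =>
      rw [pow_succ, pow_succ]
      exact (norm_mul_le _ _).trans (mul_le_mul ih hx (norm_nonneg _) ((norm_nonneg _).trans ih))
  have hc : Commute (q • a) b := hab.smul_left q
  have e1 : r ^ (n + 1) = ∑ k ∈ Finset.range (n + 2),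
      (((n + 1).choose k : ℝ) * q ^ k) • (a ^ k * b ^ (n + 1 - k)) := by
    rw [hr, hc.add_pow]
    refine Finset.sum_congr rfl fun k _ => ?_
    rw [smul_pow, smul_mul_assoc, smul_mul_assoc, mul_comm ((_ : ℕ) : ℝ), mul_smul,
      ← (Nat.cast_commute _ _).eq, ← nsmul_eq_mul, Nat.cast_smul_eq_nsmul]
  -- Size-biasing: `(n + 1) * n.choose k = (k + 1) * (n + 1).choose (k + 1)`.
  have e2 : ((n + 1) * q) • (r ^ n * a) = ∑ k ∈ Finset.range (n + 2),
      (k * (((n + 1).choose k : ℝ) * q ^ k)) • (a ^ k * b ^ (n + 1 - k)) := by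
    rw [Finset.sum_range_succ', hr, hc.add_pow, Finset.sum_mul, Finset.smul_sum]
    simp only [Nat.cast_zero, zero_mul, zero_smul, add_zero]
    refine Finset.sum_congr rfl fun k _ => ?_
    have hch : ((n + 1 : ℕ) : ℝ) * (n.choose k : ℝ) = (n + 1).choose (k + 1) * (k + 1 : ℕ) := by
      exact_mod_cast Nat.add_one_mul_choose_eq n k
    have e3 : (q • a) ^ k * b ^ (n - k) * ((n.choose k : ℕ) : 𝔸) * a
        = ((n.choose k : ℝ) * q ^ k) • (a ^ (k + 1) * b ^ (n - k)) := by
      have : b ^ (n - k) * a = a * b ^ (n - k) := (hab.pow_right _).eq.symm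
      rw [smul_pow, mul_assoc _ _ a, (Nat.cast_commute (n.choose k) a).eq, ← mul_assoc,
        mul_assoc _ _ a, this, ← mul_assoc, smul_mul_assoc, smul_mul_assoc, ← pow_succ,
        smul_mul_assoc, ← (Nat.cast_commute (n.choose k) _).eq, mul_smul, smul_comm]
      rw [Nat.cast_smul_eq_nsmul, nsmul_eq_mul]
    rw [e3, smul_smul, Nat.add_sub_add_right]
    congr 1
    push_cast at hch ⊢
    rw [pow_succ]
    linear_combination q * q ^ k * hch
  have hpos : 0 < ((n : ℝ) + 1) * q := by positivity
  have e4 : ((n + 1) * q) • (r ^ n * (r - a)) = ∑ k ∈ Finset.range (n + 2),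
      ((((n + 1).choose k : ℝ) * q ^ k) * ((n + 1) * q - k)) • (a ^ k * b ^ (n + 1 - k)) := by
    rw [mul_sub, ← pow_succ, smul_sub, e2, e1, Finset.smul_sum, ← Finset.sum_sub_distrib]
    refine Finset.sum_congr rfl fun k _ => ?_
    rw [smul_smul, ← sub_smul]
    congr 1
    ring
  have e5 : ((n + 1) * q) * ‖r ^ n * (r - a)‖ ≤ √((n + 1) * q) := by
    rw [← abs_of_pos hpos, ← Real.norm_eq_abs, ← norm_smul, e4, Real.norm_of_nonneg hpos.le]
    have := sum_binomial_abs_deviation_le (n + 1) hq.le hq1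
    push_cast at this
    refine (norm_sum_le _ _).trans (le_trans (Finset.sum_le_sum fun k _ => ?_) this)
    rw [norm_smul, norm_mul, Real.norm_of_nonneg (by positivity), Real.norm_eq_abs]
    have : ‖a ^ k * b ^ (n + 1 - k)‖ ≤ (1 - q) ^ (n + 1 - k) := by
      refine (norm_mul_le _ _).trans ?_
      have h := mul_le_mul (hpow a ha k) (hpow b hb (n + 1 - k)) (norm_nonneg _) (by positivity)
      simpa using h
    calc _ ≤ (((n + 1).choose k : ℝ) * q ^ k * |(n + 1) * q - k|) * (1 - q) ^ (n + 1 - k) := by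
          gcongr
      _ = _ := by ring
  rw [le_div_iff₀ (Real.sqrt_pos.2 hpos)]
  have hs := Real.mul_self_sqrt hpos.le
  have hsp := Real.sqrt_pos.2 hpos
  refine le_of_mul_le_mul_right ?_ hsp
  calc _ = ((n + 1) * q) * ‖r ^ n * (r - a)‖ := by rw [mul_assoc, hs, mul_comm]
    _ ≤ _ := by rw [one_mul]; exact e5

/-- Telescoping, each step costing at most the first one. -/
theorem norm_mul_one_sub_pow_le {x a : 𝔸} (ha : ‖a‖ ≤ 1) (k : ℕ) :
    ‖x * (1 - a ^ k)‖ ≤ k * ‖x * (1 - a)‖ := by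
  induction k with
  | zero => simp
  | succ k ih =>
    have : x * (1 - a ^ (k + 1)) = x * (1 - a) + x * (1 - a ^ k) * a := by
      rw [pow_succ]; noncomm_ring
    rw [this]
    have h2 : ‖x * (1 - a ^ k) * a‖ ≤ ‖x * (1 - a ^ k)‖ :=
      (norm_mul_le _ _).trans (mul_le_of_le_one_right (norm_nonneg _) ha)
    refine (norm_add_le _ _).trans ?_
    push_cast
    linarith

end NormedRing

/-! ### Averaging operators for intersection with random sets. -/

section Operators

variable {X α : Type*}

/-- The operator `φ ↦ φ (· ∩ H)` on real functions of subsets of `X`. -/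
noncomputable def restrictOp (H : Set X) : (Set X → ℝ) →L[ℝ] (Set X → ℝ) :=
  ContinuousLinearMap.pi fun K => ContinuousLinearMap.proj (K ∩ H)

/-- The operator of intersecting with a set drawn from a family with the given weights. -/
noncomputable def mixOp (s : Finset α) (w : α → ℝ) (H : α → Set X) :
    (Set X → ℝ) →L[ℝ] (Set X → ℝ) :=
  ∑ a ∈ s, w a • restrictOp (H a)

theorem restrictOp_apply (H : Set X) (φ : Set X → ℝ) (K : Set X) :
    restrictOp H φ K = φ (K ∩ H) := rfl

theorem restrictOp_univ : restrictOp (Set.univ : Set X) = 1 := by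
  ext φ K; simp [restrictOp_apply]

theorem norm_restrictOp_le [Fintype X] (H : Set X) : ‖restrictOp H‖ ≤ 1 := by
  refine ContinuousLinearMap.opNorm_le_bound _ zero_le_one fun φ => ?_
  rw [one_mul, pi_norm_le_iff_of_nonneg (norm_nonneg _)]
  exact fun K => norm_le_pi_norm φ _

theorem commute_restrictOp (H H' : Set X) : Commute (restrictOp H) (restrictOp H') := by
  ext φ K
  simp only [mul_apply_eq_comp, restrictOp_apply]
  rw [Set.inter_assoc, Set.inter_assoc, Set.inter_comm H]

theorem mixOp_apply (s : Finset α) (w : α → ℝ) (H : α → Set X) (φ : Set X → ℝ) (K : Set X) :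
    mixOp s w H φ K = ∑ a ∈ s, w a * φ (K ∩ H a) := by
  simp [mixOp, restrictOp_apply]

theorem norm_mixOp_le [Fintype X] (s : Finset α) {w : α → ℝ} (hw : ∀ a, 0 ≤ w a) (H : α → Set X) :
    ‖mixOp s w H‖ ≤ ∑ a ∈ s, w a := by
  refine (norm_sum_le _ _).trans (Finset.sum_le_sum fun a _ => ?_)
  rw [norm_smul, Real.norm_of_nonneg (hw a)]
  exact mul_le_of_le_one_right (hw a) (norm_restrictOp_le _)

theorem commute_mixOp (s t : Finset α) (w v : α → ℝ) (H : α → Set X) :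
    Commute (mixOp s w H) (mixOp t v H) := by
  refine Commute.sum_left _ _ _ fun a _ => Commute.sum_right _ _ _ fun b _ => ?_
  exact ((commute_restrictOp _ _).smul_left _).smul_right _

theorem mixOp_pow_apply [Fintype α] (w : α → ℝ) (H : α → Set X) (φ : Set X → ℝ) (m : ℕ) (K : Set X) :
    (mixOp Finset.univ w H ^ m) φ K
      = ∑ Y : Fin m → α, (∏ i, w (Y i)) * φ (K ∩ ⋂ i, H (Y i)) := by
  induction m generalizing K with
  | zero => simp
  | succ m ih =>
    rw [pow_succ', mul_apply_eq_comp, mixOp_apply,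
      ← (Fin.consEquiv fun _ : Fin (m + 1) => α).sum_comp, Fintype.sum_prod_type]
    refine Finset.sum_congr rfl fun a _ => ?_
    rw [ih, Finset.mul_sum]
    refine Finset.sum_congr rfl fun Y _ => ?_
    have : K ∩ H a ∩ ⋂ i, H (Y i) = K ∩ ⋂ i : Fin (m + 1), H (Fin.cons (α := fun _ => α) a Y i) := by
      ext x
      simp [Fin.forall_fin_succ, and_assoc]
    simp [Fin.prod_univ_succ, mul_assoc, this]

/-- Drawing one more set from the whole family or from the subfamily `s` makes little difference
after many draws. -/
theorem norm_mixOp_pow_mul_sub_le [Fintype X] [Fintype α] {w : α → ℝ} (hw : ∀ a, 0 ≤ w a) (hw1 : ∑ a, w a = 1)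
    (H : α → Set X) (s : Finset α) (hs : 0 < ∑ a ∈ s, w a) (n : ℕ) :
    ‖mixOp Finset.univ w H ^ n *
        (mixOp Finset.univ w H - (∑ a ∈ s, w a)⁻¹ • mixOp s w H)‖
      ≤ 1 / √((n + 1) * ∑ a ∈ s, w a) := by
  classical
  set q := ∑ a ∈ s, w a with hq
  have hsplit : q + ∑ a ∈ sᶜ, w a = 1 := by rw [← hw1, hq, Finset.sum_add_sum_compl]
  have hr : mixOp Finset.univ w H = q • (q⁻¹ • mixOp s w H) + mixOp sᶜ w H := by
    rw [smul_smul, mul_inv_cancel₀ hs.ne', one_smul, mixOp, mixOp, mixOp,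
      Finset.sum_add_sum_compl]
  -- Here `a` is the mixture conditioned on `s` and `b` is the remaining part, of total weight `1 -
  -- q`.
  rw [hr]
  refine norm_pow_mul_sub_le hs ?_ ?_ ?_ ?_ ?_ n
  · have := Finset.sum_nonneg fun a (_ : a ∈ sᶜ) => hw a
    linarith
  · exact (commute_mixOp _ _ _ _ _).smul_left _
  · exact ContinuousLinearMap.norm_id_le
  · rw [norm_smul, norm_inv, Real.norm_of_nonneg hs.le, inv_mul_le_iff₀ hs, mul_one]
    exact norm_mixOp_le s hw H
  · refine (norm_mixOp_le _ hw H).trans ?_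
    linarith

end Operators

/-! ### Dependence of kernel coordinates and freezing. -/

section Kernel

variable {n : ℕ}

/-- The kernel of `A` as a set of vectors. -/
def kerSet (A : Matrix (Fin n) (Fin n) (ZMod 2)) : Set (Fin n → ZMod 2) := {x | A.mulVec x = 0}

/-- The coordinate `j` is not constantly zero on `K`. -/
def IsFree (K : Set (Fin n → ZMod 2)) (j : Fin n) : Prop := ∃ x ∈ K, x j ≠ 0

/-- The set of vectors vanishing at `j`. -/
def zeroAt (j : Fin n) : Set (Fin n → ZMod 2) := {x | x j = 0}

/-- The last coordinate of `I` is free in `K`, but no longer so once the other coordinates of `I`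
are set to zero. -/
def BecomesFrozen {k : ℕ} (K : Set (Fin n → ZMod 2)) (I : Fin (k + 1) → Fin n) : Prop :=
  IsFree K (I (Fin.last k)) ∧ ¬ IsFree (K ∩ ⋂ i : Fin k, zeroAt (I i.castSucc)) (I (Fin.last k))

theorem kerProb_nonneg (A : Matrix (Fin n) (Fin n) (ZMod 2)) (P : (Fin n → ZMod 2) → Prop) :
    0 ≤ kerProb A P := by unfold kerProb; positivity

theorem kerProb_le_one (A : Matrix (Fin n) (Fin n) (ZMod 2)) (P : (Fin n → ZMod 2) → Prop) :
    kerProb A P ≤ 1 :=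
  div_le_one_of_le₀ (by exact_mod_cast Nat.card_le_card_of_injective _ Subtype.val_injective)
    (by positivity)

theorem kerProb_congr {A : Matrix (Fin n) (Fin n) (ZMod 2)} {P Q : (Fin n → ZMod 2) → Prop}
    (h : ∀ x ∈ kerSet A, (P x ↔ Q x)) : kerProb A P = kerProb A Q := by
  unfold kerProb
  congr 2
  exact Nat.card_congr (Equiv.subtypeEquivRight fun x => h x x.2)

theorem kerProb_false {A : Matrix (Fin n) (Fin n) (ZMod 2)} {P : (Fin n → ZMod 2) → Prop}
    (h : ∀ x ∈ kerSet A, ¬ P x) : kerProb A P = 0 := by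
  have : IsEmpty {x : LinearMap.ker A.mulVecLin // P x} := ⟨fun x => h x.1 x.1.2 x.2⟩
  simp [kerProb]

theorem kerProb_true {A : Matrix (Fin n) (Fin n) (ZMod 2)} {P : (Fin n → ZMod 2) → Prop}
    (h : ∀ x ∈ kerSet A, P x) : kerProb A P = 1 := by
  unfold kerProb
  rw [Nat.card_congr (Equiv.subtypeUnivEquiv fun x : LinearMap.ker A.mulVecLin => h x x.2)]
  exact div_self (by exact_mod_cast Nat.card_pos.ne')

theorem kerProb_and_add (A : Matrix (Fin n) (Fin n) (ZMod 2)) (P Q : (Fin n → ZMod 2) → Prop) :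
    kerProb A (fun x => P x ∧ Q x) + kerProb A (fun x => P x ∧ ¬ Q x) = kerProb A P := by
  classical
  unfold kerProb
  rw [← add_div, ← Nat.cast_add]
  congr 2
  rw [Nat.card_eq_fintype_card, Nat.card_eq_fintype_card, Nat.card_eq_fintype_card,
    Fintype.card_subtype, Fintype.card_subtype, Fintype.card_subtype,
    ← Finset.card_filter_add_card_filter_not (s := Finset.univ.filter
      fun x : LinearMap.ker A.mulVecLin => P x) (fun x => Q x), Finset.filter_filter,
    Finset.filter_filter]

theorem kerProb_translate {A : Matrix (Fin n) (Fin n) (ZMod 2)} {v : Fin n → ZMod 2}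
    (hv : v ∈ kerSet A) (P : (Fin n → ZMod 2) → Prop) :
    kerProb A (fun x => P (x + v)) = kerProb A P := by
  unfold kerProb
  congr 2
  exact Nat.card_congr ((Equiv.addRight (⟨v, hv⟩ : LinearMap.ker A.mulVecLin)).subtypeEquiv
    fun x => Iff.rfl)

/-- Translation by `v` preserves the uniform measure and `P` but flips coordinate `j`. -/
theorem kerProb_and_eq_half {A : Matrix (Fin n) (Fin n) (ZMod 2)} {v : Fin n → ZMod 2}
    (hv : v ∈ kerSet A) {j : Fin n} (hj : v j ≠ 0) {P : (Fin n → ZMod 2) → Prop}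
    (hP : ∀ x, P (x + v) ↔ P x) (s : ZMod 2) :
    kerProb A (fun x => P x ∧ x j = s) = kerProb A P / 2 := by
  have h1 := kerProb_and_add A P fun x => x j = s
  have h2 := kerProb_translate hv fun x => P x ∧ ¬ x j = s
  have h3 : kerProb A (fun x => P (x + v) ∧ ¬ (x + v) j = s)
      = kerProb A (fun x => P x ∧ x j = s) := by
    refine kerProb_congr fun x _ => ?_
    have : ∀ a b c : ZMod 2, b ≠ 0 → (¬ a + b = c ↔ a = c) := by decide
    rw [hP, Pi.add_apply, this _ _ _ hj]
  simp only [h3] at h2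
  linarith

/-- A frozen coordinate is constantly zero. A free one that stays free admits a kernel vector
vanishing on all earlier coordinates, so it is a fair bit independent of them. -/
theorem kerProb_eq_prod {A : Matrix (Fin n) (Fin n) (ZMod 2)} (m : ℕ) (h : m ≤ n)
    (σ : Fin m → ZMod 2)
    (hA : ∀ k : Fin m, ¬ BecomesFrozen (kerSet A)
      fun i : Fin (k + 1) => Fin.castLE (Nat.succ_le_of_lt (k.2.trans_le h)) i) :
    kerProb A (fun x => ∀ i : Fin m, x (Fin.castLE h i) = σ i)
      = ∏ i : Fin m, kerProb A (fun x => x (Fin.castLE h i) = σ i) := by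
  induction m with
  | zero => simpa using kerProb_true fun _ _ => by simp
  | succ m ih =>
    rw [Fin.prod_univ_castSucc]
    have ih' := ih (Nat.le_of_succ_le h) (fun i => σ i.castSucc) fun k => hA k.castSucc
    simp only [Fin.castLE_castSucc] at ih' ⊢
    rw [← ih']
    simp only [Fin.forall_fin_succ', Fin.castLE_castSucc]
    set P : (Fin n → ZMod 2) → Prop :=
      fun x => ∀ i : Fin m, x (Fin.castLE (Nat.le_of_succ_le h) i) = σ i.castSucc
    set j := Fin.castLE h (Fin.last m) with hj
    set s := σ (Fin.last m)
    change kerProb A (fun x => P x ∧ x j = s) = _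
    by_cases hfree : IsFree (kerSet A) j
    · have hfree' : ¬ (IsFree _ _ ∧ ¬ IsFree _ _) := hA (Fin.last m)
      rw [not_and_not_right] at hfree'
      obtain ⟨v, ⟨hvA, hv0⟩, hvj⟩ := hfree' hfree
      have hv0' : ∀ i : Fin m, v (Fin.castLE (Nat.le_of_succ_le h) i) = 0 :=
        fun i => Set.mem_iInter.1 hv0 i
      have e1 := kerProb_and_eq_half hvA (j := j) hvj (P := P)
        (fun x => forall_congr' fun i => by rw [Pi.add_apply, hv0', add_zero]) s
      have e2 := kerProb_and_eq_half hvA (j := j) hvj (P := fun _ => True) (fun x => Iff.rfl) s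
      rw [kerProb_true (P := fun _ => True) fun _ _ => trivial] at e2
      simp only [true_and] at e2
      rw [e1, e2]
      ring
    · have hz : ∀ x ∈ kerSet A, x j = 0 := fun x hx => by
        by_contra hne
        exact hfree ⟨x, hx, hne⟩
      by_cases hs : s = 0
      · rw [kerProb_true (P := fun x => x j = s) fun x hx => (hz x hx).trans hs.symm, mul_one]
        exact kerProb_congr fun x hx => and_iff_left ((hz x hx).trans hs.symm)
      · rw [kerProb_false (P := fun x => x j = s) fun x hx hx' => hs (hx' ▸ hz x hx), mul_zero]
        exact kerProb_false fun x hx hx' => hs (hx'.2 ▸ hz x hx)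

open Classical in
theorem gap_le_sum {ℓ : ℕ} (h : ℓ ≤ n) (σ : Fin ℓ → ZMod 2)
    (A : Matrix (Fin n) (Fin n) (ZMod 2)) :
    gap h σ A ≤ ∑ k : Fin ℓ, if BecomesFrozen (kerSet A)
      (fun i : Fin (k + 1) => Fin.castLE (Nat.succ_le_of_lt (k.2.trans_le h)) i)
      then (1 : ℝ) else 0 := by
  by_cases hA : ∀ k : Fin ℓ, ¬ BecomesFrozen (kerSet A)
      fun i : Fin (k + 1) => Fin.castLE (Nat.succ_le_of_lt (k.2.trans_le h)) i
  · rw [gap, kerProb_eq_prod ℓ h σ hA, sub_self, abs_zero]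
    exact Finset.sum_nonneg fun k _ => by split_ifs <;> norm_num
  · push Not at hA
    obtain ⟨k, hk⟩ := hA
    have h1 : gap h σ A ≤ 1 :=
      abs_sub_le_of_nonneg_of_le (kerProb_nonneg _ _) (kerProb_le_one _ _)
        (Finset.prod_nonneg fun i _ => kerProb_nonneg _ _)
        (Finset.prod_le_one (fun i _ => kerProb_nonneg _ _) fun i _ => kerProb_le_one _ _)
    refine h1.trans ?_
    refine le_trans ?_ (Finset.single_le_sum (fun k _ => by split_ifs <;> norm_num)
      (Finset.mem_univ k))
    rw [if_pos hk]

end Kernel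

/-! ### The random matrix as a product of row operators. -/

section Expectation

variable {n : ℕ} {d : ℝ}

/-- The probability of a given row. -/
noncomputable def rowProb (d : ℝ) (n : ℕ) (r : Fin n → ZMod 2) : ℝ :=
  ∏ j, if r j = 1 then entryProb d n else 1 - entryProb d n

theorem entryProb_nonneg (hd : 0 < d) : 0 ≤ entryProb d n :=
  le_min (by positivity) zero_le_one

theorem rowProb_nonneg (hd : 0 < d) (r : Fin n → ZMod 2) : 0 ≤ rowProb d n r := by
  refine Finset.prod_nonneg fun j _ => ?_
  split_ifs
  · exact entryProb_nonneg hd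
  · exact sub_nonneg.2 (min_le_right _ _)

theorem sum_rowProb : ∑ r, rowProb d n r = 1 := by
  unfold rowProb
  rw [← Fintype.prod_sum (fun (_ : Fin n) (a : ZMod 2) =>
    if a = 1 then entryProb d n else 1 - entryProb d n)]
  refine Finset.prod_eq_one fun j _ => ?_
  have : ∀ f : ZMod 2 → ℝ, ∑ a, f a = f 0 + f 1 := fun f => Fin.sum_univ_two f
  rw [this]
  simp

theorem rowProb_zero : rowProb d n 0 = (1 - entryProb d n) ^ n := by
  simp [rowProb]

theorem rowProb_single (j : Fin n) :
    rowProb d n (Pi.single j 1) = entryProb d n * (1 - entryProb d n) ^ (n - 1) := by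
  unfold rowProb
  rw [← Finset.mul_prod_erase _ _ (Finset.mem_univ j), Pi.single_eq_same, if_pos rfl]
  congr 1
  rw [Finset.prod_congr rfl (g := fun _ => 1 - entryProb d n), Finset.prod_const,
    Finset.card_erase_of_mem (Finset.mem_univ j), Finset.card_univ, Fintype.card_fin]
  intro i hi
  rw [Pi.single_eq_of_ne (Finset.ne_of_mem_erase hi), if_neg zero_ne_one]

theorem matrixProb_nonneg (hd : 0 < d) (A : Matrix (Fin n) (Fin n) (ZMod 2)) :
    0 ≤ matrixProb d n A := Finset.prod_nonneg fun i _ => rowProb_nonneg hd (A i)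

/-- The hyperplane orthogonal to `r`. -/
def orth (r : Fin n → ZMod 2) : Set (Fin n → ZMod 2) := {x | r ⬝ᵥ x = 0}

/-- The averaging operator that adds a random row. -/
noncomputable def rowOp (d : ℝ) (n : ℕ) :
    (Set (Fin n → ZMod 2) → ℝ) →L[ℝ] (Set (Fin n → ZMod 2) → ℝ) :=
  mixOp Finset.univ (rowProb d n) orth

/-- The averaging operator that sets a uniformly random coordinate to zero. -/
noncomputable def pinOp (n : ℕ) :
    (Set (Fin n → ZMod 2) → ℝ) →L[ℝ] (Set (Fin n → ZMod 2) → ℝ) :=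
  mixOp Finset.univ (fun _ : Fin n => (n : ℝ)⁻¹) zeroAt

/-- The kernel is the intersection of the hyperplanes of `n` independent rows. -/
theorem expect_kerSet (φ : Set (Fin n → ZMod 2) → ℝ) :
    expect d n (fun A => φ (kerSet A)) = (rowOp d n ^ n) φ Set.univ := by
  rw [rowOp, mixOp_pow_apply]
  refine Finset.sum_congr rfl fun A _ => ?_
  have : kerSet A = Set.univ ∩ ⋂ i, orth (A i) := by
    ext x
    simp [kerSet, orth, funext_iff, Matrix.mulVec]
  exact congrArg (matrixProb d n A * φ ·) this

theorem orth_single (j : Fin n) : orth (Pi.single j 1) = zeroAt j := by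
  ext x; simp [orth, zeroAt]

theorem orth_zero : orth (0 : Fin n → ZMod 2) = Set.univ := by
  ext x; simp [orth]

theorem norm_pinOp_le : ‖pinOp n‖ ≤ 1 := by
  refine (norm_mixOp_le _ (fun _ => by positivity) _).trans ?_
  rcases n.eq_zero_or_pos with rfl | hn
  · simp
  · simp [hn.ne']

theorem norm_rowOp_pow_mul_sub_one_le (hd : 0 < d) (hz : 0 < (1 - entryProb d n) ^ n) (m : ℕ) :
    ‖rowOp d n ^ m * (rowOp d n - 1)‖ ≤ 1 / √((m + 1) * (1 - entryProb d n) ^ n) := by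
  rw [← rowProb_zero] at hz ⊢
  have := norm_mixOp_pow_mul_sub_le (rowProb_nonneg hd) sum_rowProb orth {(0 : Fin n → ZMod 2)}
    (by simpa using hz) m
  have e : mixOp {0} (rowProb d n) orth = rowProb d n 0 • 1 := by
    rw [mixOp, Finset.sum_singleton, orth_zero, restrictOp_univ]
  rwa [Finset.sum_singleton, e, smul_smul, inv_mul_cancel₀ hz.ne', one_smul] at this

theorem norm_rowOp_pow_mul_sub_pinOp_le (hd : 0 < d) (m : ℕ)
    (hq : 0 < n * (entryProb d n * (1 - entryProb d n) ^ (n - 1))) :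
    ‖rowOp d n ^ m * (rowOp d n - pinOp n)‖
      ≤ 1 / √((m + 1) * (n * (entryProb d n * (1 - entryProb d n) ^ (n - 1)))) := by
  classical
  set q₁ := entryProb d n * (1 - entryProb d n) ^ (n - 1) with hq₁
  have hinj : Function.Injective fun j : Fin n => (Pi.single j 1 : Fin n → ZMod 2) :=
    fun i j hij => by simpa [Pi.single_apply] using congrFun hij i
  set s : Finset (Fin n → ZMod 2) := Finset.univ.map ⟨_, hinj⟩ with hs
  have hsum : ∑ r ∈ s, rowProb d n r = n * q₁ := by
    rw [hs, Finset.sum_map]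
    simp [rowProb_single, hq₁]
  have := norm_mixOp_pow_mul_sub_le (rowProb_nonneg hd) sum_rowProb orth s (by rwa [hsum]) m
  have e : (n * q₁)⁻¹ • mixOp s (rowProb d n) orth = pinOp n := by
    have hq1 : q₁ ≠ 0 := fun h0 => by simp [h0] at hq
    rw [pinOp, mixOp, mixOp, hs, Finset.sum_map, Finset.smul_sum]
    refine Finset.sum_congr rfl fun j _ => ?_
    rw [Function.Embedding.coeFn_mk, rowProb_single, orth_single, smul_smul, ← hq₁, mul_inv,
      inv_mul_cancel_right₀ hq1]
  rwa [hsum, e] at this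

end Expectation

/-! ### Probability that pinning freezes a coordinate. -/

section Freezing

variable {n : ℕ} {d : ℝ}

open Classical in
/-- The fraction of free coordinates. -/
noncomputable def freeFraction (K : Set (Fin n → ZMod 2)) : ℝ :=
  ∑ j, (n : ℝ)⁻¹ * if IsFree K j then 1 else 0

theorem norm_freeFraction_le : ‖(freeFraction : Set (Fin n → ZMod 2) → ℝ)‖ ≤ 1 := by
  classical
  rw [pi_norm_le_iff_of_nonneg zero_le_one]
  intro K
  rw [freeFraction, Real.norm_of_nonneg (Finset.sum_nonneg fun j _ => by positivity)]
  calc _ ≤ ∑ _j : Fin n, (n : ℝ)⁻¹ := Finset.sum_le_sum fun j _ =>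
        mul_le_of_le_one_right (by positivity) (by split_ifs <;> norm_num)
    _ ≤ 1 := by
      rw [Finset.sum_const, Finset.card_univ, Fintype.card_fin, nsmul_eq_mul]
      exact mul_inv_le_one

open Classical in
-- Tuples may repeat entries, so `k` pinned coordinates are independent uniform draws, giving `pinOp
-- n ^ k`. Pinning only destroys freeness, so the indicator is a difference of two freeness
-- indicators.
theorem sum_becomesFrozen (k : ℕ) (K : Set (Fin n → ZMod 2)) :
    ∑ I : Fin (k + 1) → Fin n, (if BecomesFrozen K I then (1 : ℝ) else 0)
      = n ^ (k + 1) * ((1 - pinOp n ^ k) freeFraction K) := by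
  rcases n.eq_zero_or_pos with rfl | hn
  · simp
  have hn' : (n : ℝ) ≠ 0 := by positivity
  have e : ∀ J : Fin k → Fin n,
      ∑ j, (if BecomesFrozen K (Fin.snoc (α := fun _ => Fin n) J j) then (1 : ℝ) else 0)
        = n * (freeFraction K - freeFraction (K ∩ ⋂ i, zeroAt (J i))) := by
    intro J
    rw [freeFraction, freeFraction, ← Finset.sum_sub_distrib, Finset.mul_sum]
    refine Finset.sum_congr rfl fun j _ => ?_
    rw [← mul_sub, mul_inv_cancel_left₀ hn']
    have hmono : IsFree (K ∩ ⋂ i, zeroAt (J i)) j → IsFree K j :=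
      fun ⟨x, hx, hxj⟩ => ⟨x, hx.1, hxj⟩
    simp only [BecomesFrozen, Fin.snoc_last, Fin.snoc_castSucc]
    by_cases h1 : IsFree K j <;> by_cases h2 : IsFree (K ∩ ⋂ i, zeroAt (J i)) j <;>
      simp_all
  rw [← (Fin.snocEquiv fun _ : Fin (k + 1) => Fin n).sum_comp, Fintype.sum_prod_type,
    Finset.sum_comm]
  have e' : (pinOp n ^ k) freeFraction K
      = ((n : ℝ) ^ k)⁻¹ * ∑ J : Fin k → Fin n, freeFraction (K ∩ ⋂ i, zeroAt (J i)) := by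
    rw [pinOp, mixOp_pow_apply, Finset.mul_sum]
    simp
  refine (Finset.sum_congr rfl fun J _ => e J).trans ?_
  rw [← Finset.mul_sum, Finset.sum_sub_distrib, Finset.sum_const, Finset.card_univ,
    Fintype.card_pi_const, Fintype.card_fin, nsmul_eq_mul]
  change _ = (n : ℝ) ^ (k + 1) * (freeFraction K - (pinOp n ^ k) freeFraction K)
  rw [e', pow_succ]
  field_simp
  push_cast
  ring

theorem becomesFrozen_submatrix {k : ℕ} (A : Matrix (Fin n) (Fin n) (ZMod 2))
    (π : Equiv.Perm (Fin n)) (I : Fin (k + 1) → Fin n) :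
    BecomesFrozen (kerSet (A.submatrix id π)) I ↔ BecomesFrozen (kerSet A) (π ∘ I) := by
  have hker : ∀ x, x ∘ π ∈ kerSet (A.submatrix id π) ↔ x ∈ kerSet A := fun x => by
    have : (A.submatrix id π).mulVec (x ∘ π) = A.mulVec x := by
      rw [Matrix.submatrix_mulVec_equiv]
      simp [Function.comp_assoc]
    simp only [kerSet, Set.mem_ofPred_eq, this]
  have hcomp : ∀ {p : (Fin n → ZMod 2) → Prop}, (∃ x, p x) ↔ ∃ x, p (x ∘ π) := fun {p} =>
    (π.arrowCongr (Equiv.refl (ZMod 2))).symm.surjective.exists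
  simp only [BecomesFrozen, IsFree, Set.mem_inter_iff, Set.mem_iInter, zeroAt,
    Set.mem_ofPred_eq]
  refine and_congr (hcomp.trans ?_) (not_congr (hcomp.trans ?_)) <;>
    simp only [hker, Function.comp_apply]

theorem matrixProb_submatrix (A : Matrix (Fin n) (Fin n) (ZMod 2)) (π : Equiv.Perm (Fin n)) :
    matrixProb d n (A.submatrix id π) = matrixProb d n A :=
  Finset.prod_congr rfl fun i _ =>
    Equiv.prod_comp π fun j => if A i j = 1 then entryProb d n else 1 - entryProb d n

open Classical in
theorem expect_becomesFrozen_comp {k : ℕ} (π : Equiv.Perm (Fin n)) (I : Fin (k + 1) → Fin n) :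
    expect d n (fun A => if BecomesFrozen (kerSet A) (π ∘ I) then 1 else 0)
      = expect d n (fun A => if BecomesFrozen (kerSet A) I then 1 else 0) := by
  unfold expect
  refine Fintype.sum_equiv (Matrix.reindex (Equiv.refl (Fin n)) π.symm) _ _ fun A => ?_
  change _ = matrixProb d n (A.submatrix id π) *
    (if BecomesFrozen (kerSet (A.submatrix id π)) I then 1 else 0)
  simp only [matrixProb_submatrix, becomesFrozen_submatrix]

theorem exists_perm_comp_eq {m : ℕ} {I J : Fin m → Fin n} (hI : Function.Injective I)
    (hJ : Function.Injective J) : ∃ π : Equiv.Perm (Fin n), π ∘ I = J := by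
  let e := (Equiv.ofInjective I hI).symm.trans (Equiv.ofInjective J hJ)
  classical
  refine ⟨e.extendSubtype, funext fun i => ?_⟩
  rw [Function.comp_apply, e.extendSubtype_apply_of_mem _ ⟨i, rfl⟩]
  simp [e]

theorem expect_sum {ι : Type*} (s : Finset ι)
    (F : ι → Matrix (Fin n) (Fin n) (ZMod 2) → ℝ) :
    expect d n (fun A => ∑ i ∈ s, F i A) = ∑ i ∈ s, expect d n (F i) := by
  unfold expect
  simp only [Finset.mul_sum]
  exact Finset.sum_comm

theorem expect_const_mul (c : ℝ) (F : Matrix (Fin n) (Fin n) (ZMod 2) → ℝ) :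
    expect d n (fun A => c * F A) = c * expect d n F := by
  unfold expect
  rw [Finset.mul_sum]
  exact Finset.sum_congr rfl fun A _ => by ring

theorem expect_mono (hd : 0 < d) {F G : Matrix (Fin n) (Fin n) (ZMod 2) → ℝ}
    (h : ∀ A, F A ≤ G A) : expect d n F ≤ expect d n G :=
  Finset.sum_le_sum fun A _ => mul_le_mul_of_nonneg_left (h A) (matrixProb_nonneg hd A)

theorem expect_nonneg (hd : 0 < d) {F : Matrix (Fin n) (Fin n) (ZMod 2) → ℝ}
    (h : ∀ A, 0 ≤ F A) : 0 ≤ expect d n F :=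
  Finset.sum_nonneg fun A _ => mul_nonneg (matrixProb_nonneg hd A) (h A)

open Classical in
-- All injective tuples have the same probability by column symmetry, and they make up at least a `2
-- ^ (-(k + 1))` share of all tuples because `n ≤ 2 * (n - k)`.
theorem expect_becomesFrozen_le (hd : 0 < d) {k : ℕ} (hk : 2 * k ≤ n)
    {I : Fin (k + 1) → Fin n} (hI : Function.Injective I) :
    expect d n (fun A => if BecomesFrozen (kerSet A) I then 1 else 0)
      ≤ 2 ^ (k + 1) * ‖rowOp d n ^ n * (1 - pinOp n ^ k)‖ := by
  set E : (Fin (k + 1) → Fin n) → ℝ :=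
    fun J => expect d n (fun A => if BecomesFrozen (kerSet A) J then 1 else 0) with hE
  have hn : 0 < n := (I 0).pos
  have hEnonneg : ∀ J, 0 ≤ E J := fun J =>
    expect_nonneg hd fun A => by split_ifs <;> norm_num
  have hcard : (Fintype.card (Fin (k + 1) ↪ Fin n) : ℝ) * E I ≤ ∑ J, E J := by
    calc _ = ∑ J : Fin (k + 1) ↪ Fin n, E J := by
          rw [← nsmul_eq_mul, ← Finset.card_univ, ← Finset.sum_const]
          refine Finset.sum_congr rfl fun J _ => ?_
          obtain ⟨π, hπ⟩ := exists_perm_comp_eq hI J.injective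
          rw [hE, ← hπ]
          exact (expect_becomesFrozen_comp π I).symm
      _ = ∑ J ∈ Finset.univ.map ⟨fun J : Fin (k + 1) ↪ Fin n => (J : Fin (k + 1) → Fin n),
            DFunLike.coe_injective⟩, E J := by rw [Finset.sum_map]; rfl
      _ ≤ _ := Finset.sum_le_sum_of_subset_of_nonneg (Finset.subset_univ _)
          fun J _ _ => hEnonneg J
  have hsum : ∑ J, E J ≤ n ^ (k + 1) * ‖rowOp d n ^ n * (1 - pinOp n ^ k)‖ := by
    simp only [hE]
    rw [← expect_sum]
    simp only [sum_becomesFrozen]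
    rw [expect_const_mul, expect_kerSet]
    gcongr
    refine (le_abs_self _).trans ?_
    rw [← Real.norm_eq_abs]
    refine (norm_le_pi_norm _ Set.univ).trans ?_
    refine ((rowOp d n ^ n * (1 - pinOp n ^ k)).le_opNorm freeFraction).trans ?_
    exact mul_le_of_le_one_right (norm_nonneg _) norm_freeFraction_le
  have hdesc : (n : ℝ) ^ (k + 1) ≤ 2 ^ (k + 1) * Fintype.card (Fin (k + 1) ↪ Fin n) := by
    rw [Fintype.card_embedding_eq, Fintype.card_fin, Fintype.card_fin]
    have h1 := Nat.pow_sub_le_descFactorial n (k + 1)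
    have h2 : n ^ (k + 1) ≤ 2 ^ (k + 1) * n.descFactorial (k + 1) := by
      calc n ^ (k + 1) ≤ (2 * (n + 1 - (k + 1))) ^ (k + 1) := Nat.pow_le_pow_left (by omega) _
        _ ≤ _ := by rw [mul_pow]; exact Nat.mul_le_mul_left _ h1
    exact_mod_cast h2
  have hnpos : (0 : ℝ) < n ^ (k + 1) := by positivity
  refine le_of_mul_le_mul_left ?_ hnpos
  calc _ ≤ (2 ^ (k + 1) * Fintype.card (Fin (k + 1) ↪ Fin n)) * E I :=
        mul_le_mul_of_nonneg_right hdesc (hEnonneg I)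
    _ = 2 ^ (k + 1) * (Fintype.card (Fin (k + 1) ↪ Fin n) * E I) := by ring
    _ ≤ 2 ^ (k + 1) * (n ^ (k + 1) * ‖rowOp d n ^ n * (1 - pinOp n ^ k)‖) := by
        have := hcard.trans hsum
        gcongr
    _ = _ := by ring

theorem expect_gap_le (hd : 0 < d) {ℓ : ℕ} (h : ℓ ≤ n) (h2 : 2 * ℓ ≤ n) (σ : Fin ℓ → ZMod 2) :
    expect d n (gap h σ) ≤ ℓ * (2 ^ ℓ * (ℓ * ‖rowOp d n ^ n * (1 - pinOp n)‖)) := by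
  classical
  refine (expect_mono hd (gap_le_sum h σ)).trans ?_
  rw [expect_sum]
  have hle : ∀ k : Fin ℓ, expect d n (fun A => if BecomesFrozen (kerSet A)
      (fun i : Fin (k + 1) => Fin.castLE (Nat.succ_le_of_lt (k.2.trans_le h)) i)
      then (1 : ℝ) else 0) ≤ 2 ^ ℓ * (ℓ * ‖rowOp d n ^ n * (1 - pinOp n)‖) := by
    intro k
    refine (expect_becomesFrozen_le hd (by omega) (Fin.castLE_injective _)).trans ?_
    have h3 : (2 : ℝ) ^ ((k : ℕ) + 1) ≤ 2 ^ ℓ := pow_le_pow_right₀ one_le_two k.2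
    have h4 : ((k : ℕ) : ℝ) ≤ ℓ := by exact_mod_cast k.2.le
    have h5 : ‖rowOp d n ^ n * (1 - pinOp n ^ (k : ℕ))‖
        ≤ ℓ * ‖rowOp d n ^ n * (1 - pinOp n)‖ :=
      (norm_mul_one_sub_pow_le norm_pinOp_le k).trans
        (mul_le_mul_of_nonneg_right h4 (norm_nonneg _))
    exact mul_le_mul h3 h5 (norm_nonneg _) (by positivity)
  refine (Finset.sum_le_sum fun k _ => hle k).trans ?_
  simp

theorem norm_rowOp_pow_mul_one_sub_pinOp_le (hd : 0 < d) {c : ℝ} (hc : 0 < c)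
    (hcz : c ≤ (1 - entryProb d n) ^ n)
    (hcq : c ≤ n * (entryProb d n * (1 - entryProb d n) ^ (n - 1))) (hn : 0 < n) :
    ‖rowOp d n ^ n * (1 - pinOp n)‖ ≤ 2 / √c * (1 / √n) := by
  have key : ∀ {q : ℝ}, c ≤ q → 1 / √(((n : ℝ) + 1) * q) ≤ 1 / √c * (1 / √n) := by
    intro q hq
    have hn' : (0 : ℝ) < n := by exact_mod_cast hn
    rw [one_div_mul_one_div, ← Real.sqrt_mul hc.le]
    have h0 : 0 < √(c * n) := Real.sqrt_pos.2 (by positivity)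
    refine one_div_le_one_div_of_le h0 (Real.sqrt_le_sqrt ?_)
    nlinarith
  have e : rowOp d n ^ n * (1 - pinOp n)
      = rowOp d n ^ n * (rowOp d n - pinOp n) - rowOp d n ^ n * (rowOp d n - 1) := by
    rw [← mul_sub, sub_sub_sub_cancel_left]
  rw [e]
  refine (norm_sub_le _ _).trans ?_
  have h1 := (norm_rowOp_pow_mul_sub_pinOp_le hd n (hc.trans_le hcq)).trans (key hcq)
  have h2 := (norm_rowOp_pow_mul_sub_one_le hd (hc.trans_le hcz) n).trans (key hcz)
  calc _ ≤ _ := add_le_add h1 h2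
    _ = _ := by ring

theorem eventually_le_prob (hd : 0 < d) : ∃ c : ℝ, 0 < c ∧ ∀ᶠ n : ℕ in atTop,
    c ≤ (1 - entryProb d n) ^ n ∧
      c ≤ n * (entryProb d n * (1 - entryProb d n) ^ (n - 1)) := by
  have hlim : Tendsto (fun n : ℕ => (1 + -d / n) ^ n) atTop (𝓝 (Real.exp (-d))) :=
    Real.tendsto_one_add_div_pow_exp (-d)
  have hpos := Real.exp_pos (-d)
  have hev := hlim.eventually_const_lt (half_lt_self hpos)
  -- Half the limits `exp (-d)` and `d * exp (-d)` of the probabilities of a zero row and of a unit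
  -- row.
  refine ⟨min (Real.exp (-d) / 2) (d * (Real.exp (-d) / 2)), by positivity, ?_⟩
  filter_upwards [hev, eventually_gt_atTop ⌈d⌉₊] with n h1 h2
  have hdn : d < n := Nat.lt_of_ceil_lt h2
  have hn : (0 : ℝ) < n := hd.trans hdn
  have hp : entryProb d n = d / n := min_eq_left ((div_le_one hn).2 hdn.le)
  have h3 : 0 ≤ 1 - d / n := sub_nonneg.2 ((div_le_one hn).2 hdn.le)
  have h4 : Real.exp (-d) / 2 ≤ (1 - d / n) ^ n := by
    rw [neg_div, ← sub_eq_add_neg] at h1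
    exact h1.le
  rw [hp]
  refine ⟨(min_le_left _ _).trans h4, (min_le_right _ _).trans ?_⟩
  rw [← mul_assoc, mul_div_cancel₀ _ hn.ne']
  refine mul_le_mul_of_nonneg_left (h4.trans ?_) hd.le
  exact pow_le_pow_of_le_one h3 (sub_le_self _ (by positivity)) (Nat.sub_le n 1)

end Freezing

end SparseParity

/-! ### The limit. -/

theorem proposition2p11 (ℓ : ℕ) (hℓ : 1 ≤ ℓ) :
    ∃ γ : ℝ, 0 < γ ∧ ∀ d : ℝ, 0 < d → ∀ σ : Fin ℓ → ZMod 2,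
      Tendsto
        (fun n : ℕ =>
          if h : ℓ ≤ n then
            SparseParity.expect d n
              (fun A => (n : ℝ) ^ γ * SparseParity.gap h σ A)
          else 0)
        atTop (𝓝 0) := by
  -- The gap is `O(n ^ (-1/2))`, so any exponent below `1 / 2` would do.
  refine ⟨1 / 4, by norm_num, fun d hd σ => ?_⟩
  obtain ⟨c, hc, hev⟩ := SparseParity.eventually_le_prob hd
  set C : ℝ := ℓ * (2 ^ ℓ * (ℓ * (2 / √c)))
  have hlim : Tendsto (fun n : ℕ => C * (n : ℝ) ^ (-(1 / 4) : ℝ)) atTop (𝓝 0) := by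
    have := ((tendsto_rpow_neg_atTop (y := 1 / 4) (by norm_num)).comp
      tendsto_natCast_atTop_atTop).const_mul C
    rwa [mul_zero] at this
  refine tendsto_of_tendsto_of_tendsto_of_le_of_le' tendsto_const_nhds hlim ?_ ?_
  · refine Eventually.of_forall fun n => ?_
    split_ifs with h
    · exact SparseParity.expect_nonneg hd fun A => mul_nonneg (by positivity) (abs_nonneg _)
    · exact le_rfl
  · filter_upwards [hev, eventually_ge_atTop (2 * ℓ)] with n hn hn2
    have h : ℓ ≤ n := by omega
    have hpos : 0 < n := by omega
    have hpos' : (0 : ℝ) < n := by exact_mod_cast hpos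
    rw [dif_pos h, SparseParity.expect_const_mul]
    have h1 := SparseParity.expect_gap_le hd h hn2 σ
    have h2 := SparseParity.norm_rowOp_pow_mul_one_sub_pinOp_le hd hc hn.1 hn.2 hpos
    calc (n : ℝ) ^ (1 / 4 : ℝ) * SparseParity.expect d n (SparseParity.gap h σ)
        ≤ (n : ℝ) ^ (1 / 4 : ℝ) * (ℓ * (2 ^ ℓ * (ℓ * (2 / √c * (1 / √n))))) := by
          refine mul_le_mul_of_nonneg_left (h1.trans ?_) (by positivity)
          gcongr
      _ = C * ((n : ℝ) ^ (1 / 4 : ℝ) * (1 / √n)) := by ring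
      _ = C * (n : ℝ) ^ (-(1 / 4) : ℝ) := by
          rw [Real.sqrt_eq_rpow, one_div (_ ^ _), ← Real.rpow_neg hpos'.le, ← Real.rpow_add hpos']
          norm_num
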